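/- Let $k\ge 2$ and $n\ge 1$ be integers. An edge-coloring of the complete graph $K_N$ is called a $(K_3,\varphi_3;k)$-coloring if exactly $k$ colors occur on the edges of $K_N$ and there is neither a monochromatic triangle nor a rainbow triangle (a triangle whose three edges have pairwise distinct colors). It is called a $(K_3,C_{2n+1},\varphi_3;k)$-coloring if, in addition, there is no monochromatic cycle of length $2n+1$. Let $R(K_3,\varphi_3;k)$ (respectively $M_k(C_{2n+1})$) denote the minimum integer $N\ge 1$ such that $K_N$ has no $(K_3,\varphi_3;k)$-coloring (respectively, no $(K_3,C_{2n+1},\varphi_3;k)$-coloring) while $K_{N-1}$ has one. 1. If $k$ is odd and $n>\dfrac{5^{(k-1)/2}-1}{2}$, then both numbers exist and $M_k(C_{2n+1})=R(K_3,\varphi_3;k)$. 2. If $k$ is even and $n>\dfrac{5^{k/2}-1}{2}$, then both numbers exist and $M_k(C_{2n+1})=R(K_3,\varphi_3;k)$. -/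

import Mathlib

namespace MixedRamsey

open SimpleGraph

/-- The edge-coloring `C` of the complete graph on `V` contains a monochromatic copy of `H`:
some color class contains a (not necessarily induced) copy of `H`. -/
def HasMono {V W K : Type} (C : TopEdgeLabeling V K) (H : SimpleGraph W) : Prop :=
  ∃ c : K, H ⊑ C.labelGraph c

/-- The edge-coloring `C` contains a rainbow triangle: three vertices whose three connecting
edges have pairwise distinct colors. -/
def HasRainbowTriangle {V K : Type} (C : TopEdgeLabeling V K) : Prop :=
  ∃ (x y z : V) (hxy : x ≠ y) (hyz : y ≠ z) (hxz : x ≠ z),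
    C.get x y hxy ≠ C.get y z hyz ∧ C.get y z hyz ≠ C.get x z hxz ∧
      C.get x y hxy ≠ C.get x z hxz

/-- There are exactly `k` colors on the edges: each of the `k` colors is used. -/
def UsesAllColors {V : Type} {k : ℕ} (C : TopEdgeLabeling V (Fin k)) : Prop :=
  ∀ c : Fin k, ∃ e, C e = c

/-- `K_N` has a `(K_3, φ_3; k)`-coloring: an edge-coloring with exactly `k` colors and without a
monochromatic or rainbow triangle. -/
def MixedColorable (k N : ℕ) : Prop :=
  ∃ C : TopEdgeLabeling (Fin N) (Fin k), UsesAllColors C ∧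
    ¬ HasMono C (completeGraph (Fin 3)) ∧ ¬ HasRainbowTriangle C

/-- `K_N` has a `(K_3, H, φ_3; k)`-coloring, where `H` stands for the monochromatic graph `H`:
an edge-coloring with exactly `k` colors and without a monochromatic triangle, a monochromatic
copy of `H`, or a rainbow triangle. -/
def MixedPatternColorable {W : Type} (H : SimpleGraph W) (k N : ℕ) : Prop :=
  ∃ C : TopEdgeLabeling (Fin N) (Fin k), UsesAllColors C ∧
    ¬ HasMono C (completeGraph (Fin 3)) ∧ ¬ HasMono C H ∧ ¬ HasRainbowTriangle C

/-- The orders `N ≥ 1` such that `K_N` has no `(K_3, φ_3; k)`-coloring but `K_{N-1}` has one. -/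
def mixedSet (k : ℕ) : Set ℕ :=
  {N | 1 ≤ N ∧ ¬ MixedColorable k N ∧ MixedColorable k (N - 1)}

/-- The orders `N ≥ 1` such that `K_N` has no `(K_3, H, φ_3; k)`-coloring but `K_{N-1}` has
one. -/
def mixedPatternSet {W : Type} (H : SimpleGraph W) (k : ℕ) : Set ℕ :=
  {N | 1 ≤ N ∧ ¬ MixedPatternColorable H k N ∧ MixedPatternColorable H k (N - 1)}

/-- The mixed Ramsey number `R(K_3, φ_3; k)` (meaningful when `mixedSet k` is nonempty). -/
noncomputable def R (k : ℕ) : ℕ := sInf (mixedSet k)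

/-- The mixed pattern Ramsey number `M_k(H) = R(K_3, H, φ_3; k)` of the monochromatic graph `H`
(meaningful when `mixedPatternSet H k` is nonempty). -/
noncomputable def M {W : Type} (k : ℕ) (H : SimpleGraph W) : ℕ := sInf (mixedPatternSet H k)

end MixedRamsey

/-! The two numbers agree because a `(K_3, φ_3; k)`-coloring and one that also avoids the odd cycle
exist for the same orders `N`. By Gallai's theorem (`IsGallai.exists_quotient`), a coloring without
rainbow triangles is a blow-up of a 2-coloring. With `R(3, 3) ≤ 6` and induction on `k` this gives
`N ≤ maxOrder k`, that is `5 ^ m` for `k = 2m` and `2 * 5 ^ m` for `k = 2m + 1`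
(`IsGallai.card_le_maxOrder`). For even `k` the hypothesis says `5 ^ m < 2n + 1`, so the cycle never
fits. For odd `k` it may fit, but then the coloring can be replaced: join two copies of the iterated
pentagon coloring on `5 ^ m` vertices by a new color. That color is bipartite, and the others stay
inside copies smaller than the cycle (`mixedPatternColorable_of_le`). -/

namespace MixedRamsey

open SimpleGraph

/-! ### Gallai colorings and their color classes. -/

/-- A symmetric function off whose diagonal no triangle is rainbow. -/
structure IsGallai {V K : Type} (c : V → V → K) : Prop where
  symm : ∀ x y, c x y = c y x
  not_rainbow : ∀ x y z, x ≠ y → y ≠ z → x ≠ z →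
    c x y = c y z ∨ c y z = c x z ∨ c x y = c x z

/-- No triangle is monochromatic. -/
def MonoTriangleFree {V K : Type} (c : V → V → K) : Prop :=
  ∀ x y z, x ≠ y → y ≠ z → x ≠ z → c x y = c y z → c y z = c x z → False

/-- The color `a` occurs off the diagonal. -/
def IsUsed {V K : Type} (c : V → V → K) (a : K) : Prop :=
  ∃ x y, x ≠ y ∧ c x y = a

/-- The graph of the edges of color `a`. -/
def colorGraph {V K : Type} (c : V → V → K) (a : K) : SimpleGraph V :=
  SimpleGraph.fromRel fun x y => c x y = a

theorem IsGallai.comp {V W K : Type} {c : V → V → K} (h : IsGallai c) {f : W → V}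
    (hf : Function.Injective f) : IsGallai fun x y => c (f x) (f y) where
  symm _ _ := h.symm _ _
  not_rainbow _ _ _ hxy hyz hxz := h.not_rainbow _ _ _ (hf.ne hxy) (hf.ne hyz) (hf.ne hxz)

theorem MonoTriangleFree.comp {V W K : Type} {c : V → V → K} (h : MonoTriangleFree c)
    {f : W → V} (hf : Function.Injective f) : MonoTriangleFree fun x y => c (f x) (f y) :=
  fun _ _ _ hxy hyz hxz => h _ _ _ (hf.ne hxy) (hf.ne hyz) (hf.ne hxz)

theorem IsGallai.colorGraph_adj {V K : Type} {c : V → V → K} (h : IsGallai c) {a : K} {x y : V} :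
    (colorGraph c a).Adj x y ↔ x ≠ y ∧ c x y = a := by
  simp [colorGraph, h.symm y x]

/-- The components of a color class are homogeneous. -/
theorem IsGallai.eq_of_reachable {V K : Type} {c : V → V → K} (h : IsGallai c) {a : K}
    {x x' y : V} (hx : (colorGraph c a).Reachable x x')
    (hy : ¬ (colorGraph c a).Reachable x y) : c x y = c x' y := by
  obtain ⟨p⟩ := hx
  induction p with
  | nil => rfl
  | @cons u v w huv p ih =>
    have hvy : ¬ (colorGraph c a).Reachable v y := fun hr => hy (huv.reachable.trans hr)
    rw [← ih hvy]
    have huy : u ≠ y := by rintro rfl; exact hy (Reachable.refl _)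
    have hvy' : v ≠ y := by rintro rfl; exact hvy (Reachable.refl _)
    have hu : c u y ≠ a := fun e => hy (h.colorGraph_adj.2 ⟨huy, e⟩).reachable
    have hv : c v y ≠ a := fun e => hvy (h.colorGraph_adj.2 ⟨hvy', e⟩).reachable
    obtain ⟨h1, h2⟩ := h.colorGraph_adj.1 huv
    -- Only `uv` has color `a`, so the other two edges must agree.
    rcases h.not_rainbow u v y h1 hvy' huy with e | e | e
    · exact absurd (e ▸ h2) hv
    · exact e.symm
    · exact absurd (e ▸ h2) hu

theorem IsGallai.eq_of_reachable_of_reachable {V K : Type} {c : V → V → K} (h : IsGallai c)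
    {a : K} {x x' y y' : V} (hx : (colorGraph c a).Reachable x x')
    (hy : (colorGraph c a).Reachable y y') (hxy : ¬ (colorGraph c a).Reachable x y) :
    c x y = c x' y' := by
  rw [h.eq_of_reachable hx hxy, h.symm x' y, h.symm x' y']
  exact h.eq_of_reachable hy fun hr => hxy (hx.trans hr.symm)

/-! ### Gallai's structure theorem. -/

/-- A Gallai coloring in at least three colors has a disconnected color class. -/
theorem IsGallai.exists_not_preconnected {K : Type} (n : ℕ) :
    ∀ (V : Type) [Fintype V] (c : V → V → K), Fintype.card V = n → IsGallai c →
      ∀ i j l, i ≠ j → j ≠ l → i ≠ l → IsUsed c i → IsUsed c j → IsUsed c l →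
      ∃ a, IsUsed c a ∧ ¬ (colorGraph c a).Preconnected := by
  classical
  induction n with
  | zero =>
    intro V _ c hV _ i _ _ _ _ _ hi
    obtain ⟨x, _⟩ := hi
    exact absurd hV (Fintype.card_pos_iff.2 ⟨x⟩).ne'
  | succ n ih =>
    intro V _ c hV hc i j l hij hjl hil hi hj hl
    -- If all used colors are connected, each of them occurs at `v`. Deleting `v` disconnects some
    -- color `m` by induction; two other colors `p`, `q` at `v` will be forced to coincide.
    by_contra! hcon
    obtain ⟨v, v', hvv', -⟩ := id hi
    have : Nontrivial V := ⟨v, v', hvv'⟩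
    have hnb : ∀ a, IsUsed c a → ∃ w, w ≠ v ∧ c w v = a := by
      intro a ha
      obtain ⟨w, hw⟩ := (hcon a ha).exists_adj_of_nontrivial v
      obtain ⟨h1, h2⟩ := hc.colorGraph_adj.1 hw
      exact ⟨w, h1.symm, by rw [hc.symm, h2]⟩
    let V' := {x : V // x ≠ v}
    let c' : V' → V' → K := fun x y => c x y
    have hc' : IsGallai c' := hc.comp Subtype.val_injective
    have hcard : Fintype.card V' = n := by
      rw [Fintype.card_subtype_compl, hV]; simp
    -- every used color is used away from `v`, for otherwise it contains the full star at `v`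
    have hused : ∀ a b, a ≠ b → IsUsed c a → IsUsed c b → IsUsed c' a := by
      intro a b hab ha hb
      by_contra hna
      obtain ⟨w, hwv, hw⟩ := hnb b hb
      obtain ⟨u, hu⟩ := (hcon a ha).exists_adj_of_nontrivial w
      obtain ⟨h1, h2⟩ := hc.colorGraph_adj.1 hu
      by_cases huv : u = v
      · subst huv; exact hab (h2.symm.trans hw)
      · exact hna ⟨⟨w, hwv⟩, ⟨u, huv⟩, fun e => h1 (congrArg Subtype.val e), h2⟩
    obtain ⟨m, hm, hmd⟩ := ih V' c' hcard hc' i j l hij hjl hil (hused i j hij hi hj)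
      (hused j l hjl hj hl) (hused l i hil.symm hl hi)
    have hmV : IsUsed c m := by
      obtain ⟨x, y, hxy, h⟩ := hm
      exact ⟨x, y, Subtype.val_injective.ne hxy, h⟩
    obtain ⟨p, q, hpq, hp, hq, hpm, hqm⟩ : ∃ p q, p ≠ q ∧ IsUsed c p ∧ IsUsed c q ∧ p ≠ m ∧
        q ≠ m := by
      by_cases h1 : i = m
      · exact ⟨j, l, hjl, hj, hl, h1 ▸ hij.symm, h1 ▸ hil.symm⟩
      · by_cases h2 : j = m
        · exact ⟨i, l, hil, hi, hl, h1, h2 ▸ hjl.symm⟩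
        · exact ⟨i, j, hij, hi, hj, h1, h2⟩
    obtain ⟨w, hwv, hw⟩ := hnb p hp
    obtain ⟨w', hwv', hw'⟩ := hnb q hq
    -- every component of color `m` away from `v` is joined to `v` in color `m`
    have hjoin : ∀ x : V', ∃ u : V', (colorGraph c' m).Reachable x u ∧ c u v = m := by
      intro x
      by_contra! hno
      have key : ∀ y z : V, (colorGraph c m).Reachable y z →
          (∃ hy : y ≠ v, (colorGraph c' m).Reachable x ⟨y, hy⟩) →
          ∃ hz : z ≠ v, (colorGraph c' m).Reachable x ⟨z, hz⟩ := by
        rintro y z ⟨r⟩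
        induction r with
        | nil => exact id
        | @cons a b d hab r ihr =>
          rintro ⟨ha, hr⟩
          obtain ⟨h1, h2⟩ := hc.colorGraph_adj.1 hab
          have hbv : b ≠ v := by rintro rfl; exact hno _ hr h2
          refine ihr ⟨hbv, hr.trans (Adj.reachable ?_)⟩
          exact hc'.colorGraph_adj.2 ⟨fun e => h1 (congrArg Subtype.val e), h2⟩
      obtain ⟨hz, -⟩ := key x v (hcon m hmV x v) ⟨x.2, Reachable.refl _⟩
      exact hz rfl
    have hcolor : ∀ (x : V') (u : V') (a : K), c x v = a → a ≠ m → c u v = m →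
        ¬ (colorGraph c' m).Reachable x u → c' x u = a := by
      intro x u a hx ham hu hxu
      have hne : x ≠ u := by rintro rfl; exact hxu (Reachable.refl _)
      have hm' : c' x u ≠ m := fun e => hxu (hc'.colorGraph_adj.2 ⟨hne, e⟩).reachable
      rcases hc.not_rainbow x u v (Subtype.val_injective.ne hne) u.2 x.2 with e | e | e
      · exact absurd (e.trans hu) hm'
      · exact absurd (hx.symm.trans (e.symm.trans hu)) ham
      · exact e.trans hx
    -- By homogeneity one color joins two `m`-components. It is `p` by `hcolor` at `w` and `q` by
    -- `hcolor` at `w'`.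
    by_cases hww : (colorGraph c' m).Reachable ⟨w, hwv⟩ ⟨w', hwv'⟩
    · obtain ⟨y, hy⟩ : ∃ y, ¬ (colorGraph c' m).Reachable ⟨w, hwv⟩ y := by
        by_contra! hall
        exact hmd fun s t => (hall s).symm.trans (hall t)
      obtain ⟨u, hyu, hu⟩ := hjoin y
      have h1 : ¬ (colorGraph c' m).Reachable ⟨w, hwv⟩ u := fun hr => hy (hr.trans hyu.symm)
      have h2 : ¬ (colorGraph c' m).Reachable ⟨w', hwv'⟩ u := fun hr => h1 (hww.trans hr)
      exact hpq ((hcolor _ _ _ hw hpm hu h1).symm.trans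
        ((hc'.eq_of_reachable hww h1).trans (hcolor _ _ _ hw' hqm hu h2)))
    · obtain ⟨u, hwu, hu⟩ := hjoin ⟨w, hwv⟩
      obtain ⟨u', hwu', hu'⟩ := hjoin ⟨w', hwv'⟩
      have h1 : ¬ (colorGraph c' m).Reachable ⟨w, hwv⟩ u' := fun hr => hww (hr.trans hwu'.symm)
      have h2 : ¬ (colorGraph c' m).Reachable ⟨w', hwv'⟩ u :=
        fun hr => hww (hwu.trans hr.symm)
      have e1 := hcolor _ _ _ hw hpm hu' h1
      have e2 := hcolor _ _ _ hw' hqm hu h2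
      have e3 := hc'.eq_of_reachable_of_reachable hwu hwu'.symm h1
      rw [e1, hc'.symm, e2] at e3
      exact hpq e3

/-- Gallai's theorem: a Gallai coloring is a substitution into a nontrivial 2-coloring. -/
theorem IsGallai.exists_quotient {K : Type} (n : ℕ) :
    ∀ (V : Type) [Fintype V] [Nontrivial V] (c : V → V → K), Fintype.card V = n → IsGallai c →
      ∃ (W : Type) (_ : Fintype W) (_ : Nontrivial W) (π : V → W) (d : W → W → K) (a b : K),
        Function.Surjective π ∧ (∀ x y, π x ≠ π y → c x y = d (π x) (π y)) ∧
        ∀ w w', w ≠ w' → d w w' = a ∨ d w w' = b := by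
  classical
  induction n using Nat.strong_induction_on with
  | _ n ih =>
    intro V _ _ c hV hc
    by_cases h3 : ∃ i j l, i ≠ j ∧ j ≠ l ∧ i ≠ l ∧ IsUsed c i ∧ IsUsed c j ∧ IsUsed c l
    · obtain ⟨i, j, l, hij, hjl, hil, hi, hj, hl⟩ := h3
      obtain ⟨m, ⟨x₀, y₀, hxy₀, hm₀⟩, hm⟩ :=
        exists_not_preconnected n V c hV hc i j l hij hjl hil hi hj hl
      -- Contract the components of `m`: representatives inherit the Gallai property, and there are
      -- fewer of them because `m` is used.
      let G := colorGraph c m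
      let e : G.ConnectedComponent → G.ConnectedComponent → K :=
        fun A B => c (Quot.out A) (Quot.out B)
      have hout : ∀ A : G.ConnectedComponent, G.connectedComponentMk (Quot.out A) = A :=
        fun A => Quot.out_eq A
      have hinj : Function.Injective (Quot.out : G.ConnectedComponent → V) :=
        fun A B h => by rw [← hout A, ← hout B, h]
      have : Fintype G.ConnectedComponent := Fintype.ofFinite _
      have hnt : Nontrivial G.ConnectedComponent := by
        by_contra hn
        rw [not_nontrivial_iff_subsingleton] at hn
        exact hm fun x y => ConnectedComponent.exact (Subsingleton.elim _ _)
      have hlt : Fintype.card G.ConnectedComponent < n := by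
        rw [← hV]
        refine Fintype.card_lt_of_surjective_not_injective G.connectedComponentMk
          (fun A => ⟨_, hout A⟩) fun hi => hxy₀ (hi ?_)
        exact ConnectedComponent.sound (hc.colorGraph_adj.2 ⟨hxy₀, hm₀⟩).reachable
      obtain ⟨W, hW, hW', π, d, a, b, hπ, hd, hab⟩ :=
        ih _ hlt G.ConnectedComponent e rfl (hc.comp hinj)
      refine ⟨W, hW, hW', π ∘ G.connectedComponentMk, d, a, b,
        hπ.comp fun A => ⟨_, hout A⟩, fun x y hxy => ?_, hab⟩
      have hne : G.connectedComponentMk x ≠ G.connectedComponentMk y := fun h => hxy (by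
        simp only [Function.comp, h])
      refine Eq.trans ?_ (hd _ _ hxy)
      exact hc.eq_of_reachable_of_reachable (ConnectedComponent.exact (hout _).symm)
        (ConnectedComponent.exact (hout _).symm) fun h => hne (ConnectedComponent.sound h)
    · obtain ⟨x, y, hxy⟩ := exists_pair_ne V
      have ha : IsUsed c (c x y) := ⟨x, y, hxy, rfl⟩
      by_cases hb : ∃ b, IsUsed c b ∧ b ≠ c x y
      · obtain ⟨b, hb, hne⟩ := hb
        refine ⟨V, inferInstance, inferInstance, id, c, c x y, b, Function.surjective_id,
          fun _ _ _ => rfl, fun w w' hw => ?_⟩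
        by_contra! hcon
        exact h3 ⟨_, _, _, hne.symm, hcon.2.symm, hcon.1.symm, ha, hb, w, w', hw, rfl⟩
      · push Not at hb
        exact ⟨V, inferInstance, inferInstance, id, c, c x y, c x y, Function.surjective_id,
          fun _ _ _ => rfl, fun w w' hw => Or.inl (hb _ ⟨w, w', hw, rfl⟩)⟩

/-! ### The upper bound on the order. -/

/-- The bound `R(3, 3) ≤ 6`. -/
theorem card_le_five {W K : Type} [Fintype W] {d : W → W → K} (hd : MonoTriangleFree d)
    {a b : K} (hab : ∀ w w', w ≠ w' → d w w' = a ∨ d w w' = b) : Fintype.card W ≤ 5 := by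
  classical
  have main : ∀ (a b : K) (w : W), (∀ w w', w ≠ w' → d w w' = a ∨ d w w' = b) →
      ((Finset.univ.erase w).filter fun x => d w x = a).card ≤ 2 := by
    intro a b w hab
    by_contra! h
    obtain ⟨x, y, z, hx, hy, hz, hxy, hxz, hyz⟩ := Finset.two_lt_card_iff.1 h
    simp only [Finset.mem_filter, Finset.mem_erase, Finset.mem_univ, and_true] at hx hy hz
    have key : ∀ s t, s ≠ t → s ≠ w → t ≠ w → d w s = a → d w t = a → d s t = b := by
      intro s t hst hs ht es et
      refine (hab s t hst).resolve_left fun e => ?_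
      exact hd w s t hs.symm hst ht.symm (es.trans e.symm) (e.trans et.symm)
    have e1 := key x y hxy hx.1 hy.1 hx.2 hy.2
    have e2 := key y z hyz hy.1 hz.1 hy.2 hz.2
    have e3 := key x z hxz hx.1 hz.1 hx.2 hz.2
    exact hd x y z hxy hyz hxz (e1.trans e2.symm) (e2.trans e3.symm)
  rcases isEmpty_or_nonempty W with _ | ⟨⟨w⟩⟩
  · simp
  have h1 := main a b w hab
  have h2 := main b a w fun w w' h => (hab w w' h).symm
  have h3 : Finset.univ.erase w ⊆ ((Finset.univ.erase w).filter fun x => d w x = a) ∪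
      ((Finset.univ.erase w).filter fun x => d w x = b) := by
    intro x hx
    simp only [Finset.mem_union, Finset.mem_filter, hx, true_and]
    exact hab w x (Finset.ne_of_mem_erase hx).symm
  have h4 := (Finset.card_le_card h3).trans (Finset.card_union_le _ _)
  rw [Finset.card_erase_of_mem (Finset.mem_univ _), Finset.card_univ] at h4
  omega

/-- The largest order of a complete graph that has a Gallai coloring in `k` colors without
monochromatic triangles. -/
def maxOrder : ℕ → ℕ
  | 0 => 1
  | 1 => 2
  | k + 2 => 5 * maxOrder k

theorem one_le_maxOrder : ∀ k, 1 ≤ maxOrder k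
  | 0 => le_rfl
  | 1 => by simp [maxOrder]
  | k + 2 => by
    have := one_le_maxOrder k
    simp only [maxOrder]; omega

/-- Covers the case of a bipartition whose crossing edges share one color. -/
theorem two_mul_maxOrder_le : ∀ k, 2 * maxOrder k ≤ maxOrder (k + 1)
  | 0 => by simp [maxOrder]
  | 1 => by simp [maxOrder]
  | k + 2 => by
    have := two_mul_maxOrder_le k
    simp only [maxOrder] at this ⊢; omega

theorem maxOrder_two_mul (m : ℕ) : maxOrder (2 * m) = 5 ^ m := by
  induction m with
  | zero => rfl
  | succ m ih => rw [Nat.mul_succ, maxOrder, ih, pow_succ']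

theorem maxOrder_two_mul_add_one (m : ℕ) : maxOrder (2 * m + 1) = 2 * 5 ^ m := by
  induction m with
  | zero => rfl
  | succ m ih =>
    rw [show 2 * (m + 1) + 1 = (2 * m + 1) + 2 by ring, maxOrder, ih, pow_succ']; ring

/-- A color joining a set of vertices to one outside vertex cannot occur inside the set. If one part
sees the rest in a single color, both sides lose that color. Otherwise every part sees, and loses,
both quotient colors, and there are at most five parts. The palette `P` is a variable so that colors
can be erased. -/
theorem IsGallai.card_le_maxOrder {K : Type} (k : ℕ) :
    ∀ (P : Finset K) (V : Type) [Fintype V] (c : V → V → K), P.card = k → IsGallai c →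
      MonoTriangleFree c → (∀ x y, x ≠ y → c x y ∈ P) → Fintype.card V ≤ maxOrder k := by
  classical
  induction k using Nat.strong_induction_on with
  | _ k ih =>
    intro P V _ c hP hc hm hcP
    rcases subsingleton_or_nontrivial V with _ | _
    · exact (Fintype.card_le_one_iff_subsingleton.2 inferInstance).trans (one_le_maxOrder k)
    obtain ⟨W, _, _, π, d, a, b, hπ, hd, hab⟩ := IsGallai.exists_quotient _ V c rfl hc
    have hdm : MonoTriangleFree d := by
      intro w₁ w₂ w₃ h12 h23 h13 e1 e2
      obtain ⟨x, rfl⟩ := hπ w₁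
      obtain ⟨y, rfl⟩ := hπ w₂
      obtain ⟨z, rfl⟩ := hπ w₃
      rw [← hd _ _ h12, ← hd _ _ h23] at e1
      rw [← hd _ _ h23, ← hd _ _ h13] at e2
      exact hm x y z (ne_of_apply_ne π h12) (ne_of_apply_ne π h23) (ne_of_apply_ne π h13) e1 e2
    have hnot : ∀ {x y z : V} {e : K}, x ≠ y → x ≠ z → y ≠ z → c x z = e → c y z = e →
        c x y ≠ e := fun hxy hxz hyz h1 h2 h3 =>
      hm _ _ _ hxy hyz hxz (h3.trans h2.symm) (h2.trans h1.symm)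
    by_cases hone : ∃ w e, ∀ w', w' ≠ w → d w' w = e
    · obtain ⟨w, e, he⟩ := hone
      obtain ⟨w', hw'⟩ := exists_ne w
      obtain ⟨x₀, rfl⟩ := hπ w
      obtain ⟨y₀, rfl⟩ := hπ w'
      have hcross : ∀ x y, π x ≠ π x₀ → π y = π x₀ → c x y = e := by
        intro x y hx hy
        rw [hd x y (by rwa [hy]), hy, he _ hx]
      have heP : e ∈ P := by
        rw [← hcross y₀ x₀ hw' rfl]; exact hcP _ _ (ne_of_apply_ne π hw')
      obtain ⟨k, rfl⟩ : ∃ k', k = k' + 1 :=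
        ⟨k - 1, by have := Finset.card_pos.2 ⟨e, heP⟩; omega⟩
      have hPe : (P.erase e).card = k := by rw [Finset.card_erase_of_mem heP, hP]; rfl
      have h1 := ih k (Nat.lt_succ_self k) (P.erase e) {x // π x = π x₀} (fun x y => c x y) hPe
        (hc.comp Subtype.val_injective) (hm.comp Subtype.val_injective) (by
          intro x y hxy
          have hxy' := Subtype.val_injective.ne hxy
          have hx : x.1 ≠ y₀ := by rintro rfl; exact hw' x.2
          have hy : y.1 ≠ y₀ := by rintro rfl; exact hw' y.2
          refine Finset.mem_erase.2 ⟨hnot hxy' hx hy ?_ ?_, hcP _ _ hxy'⟩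
          · rw [hc.symm]; exact hcross _ _ hw' x.2
          · rw [hc.symm]; exact hcross _ _ hw' y.2)
      have h2 := ih k (Nat.lt_succ_self k) (P.erase e) {x // ¬ π x = π x₀} (fun x y => c x y) hPe
        (hc.comp Subtype.val_injective) (hm.comp Subtype.val_injective) (by
          intro x y hxy
          have hxy' := Subtype.val_injective.ne hxy
          exact Finset.mem_erase.2 ⟨hnot hxy' (ne_of_apply_ne π x.2) (ne_of_apply_ne π y.2)
            (hcross _ _ x.2 rfl) (hcross _ _ y.2 rfl), hcP _ _ hxy'⟩)
      have h3 := Fintype.card_subtype_compl fun x => π x = π x₀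
      have h4 := Fintype.card_subtype_le fun x => π x = π x₀
      have h5 := two_mul_maxOrder_le k
      omega
    · push Not at hone
      have hsee : ∀ x, (∃ z, π z ≠ π x ∧ c z x = a) ∧ ∃ z, π z ≠ π x ∧ c z x = b := by
        intro x
        constructor
        · obtain ⟨w', hw', h⟩ := hone (π x) b
          obtain ⟨z, rfl⟩ := hπ w'
          exact ⟨z, hw', by rw [hd _ _ hw']; exact (hab _ _ hw').resolve_right h⟩
        · obtain ⟨w', hw', h⟩ := hone (π x) a
          obtain ⟨z, rfl⟩ := hπ w'
          exact ⟨z, hw', by rw [hd _ _ hw']; exact (hab _ _ hw').resolve_left h⟩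
      obtain ⟨x₀⟩ : Nonempty V := inferInstance
      have hne : a ≠ b := by
        rintro rfl
        obtain ⟨w', hw', h⟩ := hone (π x₀) a
        exact h ((or_self_iff).1 (hab _ _ hw'))
      have haP : a ∈ P := by
        obtain ⟨z, hz, rfl⟩ := (hsee x₀).1; exact hcP _ _ (ne_of_apply_ne π hz)
      have hbP : b ∈ P.erase a := by
        refine Finset.mem_erase.2 ⟨hne.symm, ?_⟩
        obtain ⟨z, hz, rfl⟩ := (hsee x₀).2; exact hcP _ _ (ne_of_apply_ne π hz)
      have c1 := Finset.card_erase_of_mem haP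
      have c2 := Finset.card_erase_of_mem hbP
      have c3 := Finset.card_pos.2 ⟨b, hbP⟩
      obtain ⟨k, rfl⟩ : ∃ k', k = k' + 2 := ⟨k - 2, by omega⟩
      have hfib : ∀ w, Fintype.card {x // π x = w} ≤ maxOrder k := by
        intro w
        obtain ⟨x₁, rfl⟩ := hπ w
        refine ih k (by omega) ((P.erase a).erase b) {x // π x = π x₁} (fun x y => c x y)
          (by omega) (hc.comp Subtype.val_injective) (hm.comp Subtype.val_injective) ?_
        intro x y hxy
        have hxy' := Subtype.val_injective.ne hxy
        have hav : ∀ e, (∃ z, π z ≠ π x₁ ∧ c z x₁ = e) → c x y ≠ e := by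
          rintro e ⟨z, hz, he⟩
          have hx : π x.1 ≠ π z := by rw [x.2]; exact hz.symm
          have hy : π y.1 ≠ π z := by rw [y.2]; exact hz.symm
          have hz' := hd _ _ hz
          refine hnot hxy' (ne_of_apply_ne π hx) (ne_of_apply_ne π hy) ?_ ?_
          · rw [hc.symm, hd _ _ hx.symm, x.2, ← hz', he]
          · rw [hc.symm, hd _ _ hy.symm, y.2, ← hz', he]
        exact Finset.mem_erase.2 ⟨hav b (hsee x₁).2, Finset.mem_erase.2
          ⟨hav a (hsee x₁).1, hcP _ _ hxy'⟩⟩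
      calc Fintype.card V = ∑ w, Fintype.card {x // π x = w} := by
            rw [← Fintype.card_sigma]
            exact Fintype.card_congr (Equiv.sigmaFiberEquiv π).symm
        _ ≤ ∑ _w : W, maxOrder k := Finset.sum_le_sum fun w _ => hfib w
        _ = Fintype.card W * maxOrder k := by simp
        _ ≤ 5 * maxOrder k := Nat.mul_le_mul_right _ (card_le_five hdm hab)

/-! ### Extremal colorings by substitution. -/

/-- A Gallai coloring without monochromatic triangles in the colors below `k`, all of which occur
at the vertex `z`. -/
structure IsStarColoring {V : Type} (c : V → V → ℕ) (k : ℕ) (z : V) : Prop where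
  gallai : IsGallai c
  mono_free : MonoTriangleFree c
  lt : ∀ x y, x ≠ y → c x y < k
  star : ∀ a < k, ∃ y, z ≠ y ∧ c z y = a

/-- The coloring `c` with a copy of `d`, in new colors, substituted for each vertex. -/
def substitution {V W : Type} [DecidableEq V] (c : V → V → ℕ) (k : ℕ) (d : W → W → ℕ)
    (p q : V × W) : ℕ :=
  if p.1 = q.1 then k + d p.2 q.2 else c p.1 q.1

/-- A triangle meeting exactly two fibers has two equal edges below `k` and a third edge at least
`k`; all other triangles come from `c` or `d`. -/
theorem IsStarColoring.substitution {V W : Type} [DecidableEq V] {c : V → V → ℕ}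
    {d : W → W → ℕ} {k l : ℕ} {z : V} {z' : W} (hc : IsStarColoring c k z)
    (hd : IsStarColoring d l z') : IsStarColoring (substitution c k d) (k + l) (z, z') where
  gallai := by
    refine ⟨fun p q => ?_, ?_⟩
    · simp only [MixedRamsey.substitution, eq_comm (a := q.1), hc.gallai.symm q.1,
        hd.gallai.symm q.2]
    · rintro ⟨x, i⟩ ⟨y, j⟩ ⟨t, r⟩ h1 h2 h3
      rw [Ne, Prod.mk.injEq] at h1 h2 h3
      have e1 := hc.gallai.not_rainbow x y t
      have e2 := hd.gallai.not_rainbow i j r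
      have e3 := hc.gallai.symm x y
      simp only [MixedRamsey.substitution]
      grind
  mono_free := by
    rintro ⟨x, i⟩ ⟨y, j⟩ ⟨t, r⟩ h1 h2 h3
    rw [Ne, Prod.mk.injEq] at h1 h2 h3
    have e1 := hc.mono_free x y t
    have e2 := hd.mono_free i j r
    have e3 := hc.lt x y
    have e4 := hc.lt y t
    have e5 := hc.lt x t
    simp only [MixedRamsey.substitution]
    grind
  lt := by
    rintro ⟨x, i⟩ ⟨y, j⟩ h
    rw [Ne, Prod.mk.injEq] at h
    have e3 := hc.lt x y
    have e4 := hd.lt i j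
    simp only [MixedRamsey.substitution]
    grind
  star := by
    intro a ha
    by_cases hak : a < k
    · obtain ⟨y, hy, h⟩ := hc.star a hak
      exact ⟨(y, z'), by simp [hy], by simp [MixedRamsey.substitution, hy, h]⟩
    · obtain ⟨y, hy, h⟩ := hd.star (a - k) (by omega)
      exact ⟨(z, y), by simp [hy], by simp [MixedRamsey.substitution, h]; omega⟩

/-- The decomposition of `K_5` into two pentagons. -/
def pentagonColoring (i j : Fin 5) : ℕ := if i - j = 1 ∨ j - i = 1 then 0 else 1

theorem isStarColoring_pentagonColoring : IsStarColoring pentagonColoring 2 0 where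
  gallai := ⟨by decide, by decide⟩
  mono_free := by unfold MonoTriangleFree; decide
  lt := by decide
  star := by decide

theorem isStarColoring_edge : IsStarColoring (fun _ _ : Bool => 0) 1 false where
  gallai := ⟨fun _ _ => rfl, fun _ _ _ _ _ _ => Or.inl rfl⟩
  mono_free := by unfold MonoTriangleFree; decide
  lt _ _ _ := Nat.one_pos
  star a ha := ⟨true, by decide, by omega⟩

theorem exists_isStarColoring (m : ℕ) : ∃ (V : Type) (_ : Fintype V) (c : V → V → ℕ) (z : V),
    Fintype.card V = 5 ^ m ∧ IsStarColoring c (2 * m) z := by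
  classical
  induction m with
  | zero =>
    exact ⟨Unit, inferInstance, fun _ _ => 0, (), rfl,
      ⟨fun _ _ => rfl, fun _ _ _ _ _ _ => Or.inl rfl⟩,
      fun _ _ _ h => (h rfl).elim, fun _ _ h => (h rfl).elim, fun _ h => by omega⟩
  | succ m ih =>
    obtain ⟨V, _, c, z, hV, hc⟩ := ih
    exact ⟨V × Fin 5, inferInstance, _, _, by simp [hV, pow_succ],
      hc.substitution isStarColoring_pentagonColoring⟩

/-- The center and one neighbor per color show all colors on at most `k + 1` vertices; any `N`-set
containing them will do. -/
theorem IsStarColoring.exists_embedding {V : Type} [Fintype V] {c : V → V → ℕ} {k N : ℕ} {z : V}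
    (hc : IsStarColoring c k z) (hkN : k + 1 ≤ N) (hN : N ≤ Fintype.card V) :
    ∃ f : Fin N ↪ V, ∀ a < k, ∃ x y, x ≠ y ∧ c (f x) (f y) = a := by
  classical
  have : Nonempty V := ⟨z⟩
  choose! t ht h using hc.star
  have hcard : (insert z ((Finset.range k).image t)).card ≤ N :=
    (Finset.card_insert_le _ _).trans
      ((Nat.add_le_add_right (Finset.card_image_le.trans (Finset.card_range k).le) 1).trans hkN)
  obtain ⟨S, hS, hSN⟩ := Finset.exists_superset_card_eq hcard hN
  let e := S.equivFinOfCardEq hSN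
  refine ⟨e.symm.toEmbedding.trans (Function.Embedding.subtype _), fun a ha => ?_⟩
  have hz : z ∈ S := hS (Finset.mem_insert_self _ _)
  have hy : t a ∈ S := hS (Finset.mem_insert_of_mem
    (Finset.mem_image_of_mem _ (Finset.mem_range.2 ha)))
  refine ⟨e ⟨z, hz⟩, e ⟨t a, hy⟩, e.injective.ne ?_, by simpa using h a ha⟩
  exact fun e => ht a ha (congrArg Subtype.val e)

/-! ### Transfer to edge labelings and comparison of the Ramsey sets. -/

/-- The edge-coloring induced by a star coloring on the range of an embedding. -/
def IsStarColoring.labeling {V : Type} {c : V → V → ℕ} {k N : ℕ} {z : V}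
    (hc : IsStarColoring c k z) (f : Fin N ↪ V) : TopEdgeLabeling (Fin N) (Fin k) :=
  EdgeLabeling.mk (fun x y h => ⟨c (f x) (f y), hc.lt _ _ (f.injective.ne h)⟩)
    fun _ _ _ => Fin.ext (hc.gallai.symm _ _)

theorem IsStarColoring.labeling_spec {V : Type} {c : V → V → ℕ} {k N : ℕ} {z : V}
    (hc : IsStarColoring c k z) (f : Fin N ↪ V)
    (hf : ∀ a < k, ∃ x y, x ≠ y ∧ c (f x) (f y) = a) :
    UsesAllColors (hc.labeling f) ∧ ¬ HasMono (hc.labeling f) (completeGraph (Fin 3)) ∧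
      ¬ HasRainbowTriangle (hc.labeling f) := by
  refine ⟨fun a => ?_, ?_, ?_⟩
  · obtain ⟨x, y, hxy, h⟩ := hf a a.2
    exact ⟨⟨s(x, y), hxy⟩, Fin.ext h⟩
  · rintro ⟨a, ⟨φ⟩⟩
    have key : ∀ i j : Fin 3, i ≠ j → f (φ i) ≠ f (φ j) ∧ c (f (φ i)) (f (φ j)) = a := by
      intro i j hij
      obtain ⟨H, h⟩ := (TopEdgeLabeling.labelGraph_adj _ _).1
        (φ.toHom.map_adj (show (completeGraph (Fin 3)).Adj i j from hij))
      exact ⟨f.injective.ne H, congrArg Fin.val h⟩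
    have h01 := key 0 1 (by decide)
    have h12 := key 1 2 (by decide)
    have h02 := key 0 2 (by decide)
    exact hc.mono_free _ _ _ h01.1 h12.1 h02.1 (h01.2.trans h12.2.symm) (h12.2.trans h02.2.symm)
  · rintro ⟨x, y, w, hxy, hyw, hxw, h1, h2, h3⟩
    rcases hc.gallai.not_rainbow _ _ _ (f.injective.ne hxy) (f.injective.ne hyw)
      (f.injective.ne hxw) with h | h | h
    · exact h1 (Fin.ext h)
    · exact h2 (Fin.ext h)
    · exact h3 (Fin.ext h)

theorem MixedColorable.le_maxOrder {k N : ℕ} (hk : 1 ≤ k) (h : MixedColorable k N) :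
    N ≤ maxOrder k := by
  obtain ⟨C, -, hm, hr⟩ := h
  -- The diagonal value is arbitrary; `hk` only supplies a color for it.
  let c : Fin N → Fin N → Fin k := fun x y => if h : x ≠ y then C.get x y h else ⟨0, hk⟩
  have hcg : ∀ {x y} (h : x ≠ y), c x y = C.get x y h := fun h => dif_pos h
  have hc : IsGallai c := by
    refine ⟨fun x y => ?_, fun x y z hxy hyz hxz => ?_⟩
    · by_cases h : x = y
      · rw [h]
      · rw [hcg h, hcg (Ne.symm h)]; exact EdgeLabeling.get_comm _ _ _
    · by_contra! hcon
      rw [hcg hxy, hcg hyz, hcg hxz] at hcon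
      exact hr ⟨x, y, z, hxy, hyz, hxz, hcon⟩
  have hcm : MonoTriangleFree c := by
    intro x y z hxy hyz hxz h1 h2
    refine hm ⟨c x y, not_cliqueFree_iff_top_isContained _ |>.1 fun hf => ?_⟩
    refine hf {x, y, z} (is3Clique_triple_iff.2 ⟨?_, ?_, ?_⟩) <;>
      rw [TopEdgeLabeling.labelGraph_adj]
    · exact ⟨hxy, (hcg hxy).symm⟩
    · exact ⟨hxz, by rw [← hcg hxz, h1, h2]⟩
    · exact ⟨hyz, by rw [← hcg hyz, h1]⟩
  simpa using IsGallai.card_le_maxOrder k Finset.univ (Fin N) c (by simp) hc hcm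
    fun _ _ _ => Finset.mem_univ _

theorem MixedPatternColorable.mixedColorable {W : Type} {H : SimpleGraph W} {k N : ℕ}
    (h : MixedPatternColorable H k N) : MixedColorable k N := by
  obtain ⟨C, h1, h2, -, h3⟩ := h
  exact ⟨C, h1, h2, h3⟩

theorem mixedPatternColorable_cycleGraph_of_lt {l k N : ℕ} (hN : N < l)
    (h : MixedColorable k N) : MixedPatternColorable (cycleGraph l) k N := by
  obtain ⟨C, h1, h2, h3⟩ := h
  refine ⟨C, h1, h2, ?_, h3⟩
  rintro ⟨a, ⟨φ⟩⟩
  have := Fintype.card_le_of_injective φ φ.injective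
  simp at this
  omega

theorem mixedColorable_of_le {m N : ℕ} (h1 : 2 * m + 1 ≤ N) (h2 : N ≤ 5 ^ m) :
    MixedColorable (2 * m) N := by
  obtain ⟨V, _, c, z, hV, hc⟩ := exists_isStarColoring m
  obtain ⟨f, hf⟩ := hc.exists_embedding h1 (hV ▸ h2)
  exact ⟨hc.labeling f, hc.labeling_spec f hf⟩

theorem mixedPatternColorable_of_le {m n N : ℕ} (hn : 1 ≤ n) (hmn : 5 ^ m < 2 * n + 1)
    (h1 : 2 * m + 2 ≤ N) (h2 : N ≤ 2 * 5 ^ m) :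
    MixedPatternColorable (cycleGraph (2 * n + 1)) (2 * m + 1) N := by
  obtain ⟨V, _, c, z, hV, hc⟩ := exists_isStarColoring m
  -- The edge is the outer coloring, so color `0` runs exactly between the two copies.
  have hs : IsStarColoring (substitution (fun _ _ : Bool => 0) 1 c) (2 * m + 1) (false, z) := by
    rw [add_comm]; exact isStarColoring_edge.substitution hc
  obtain ⟨f, hf⟩ := hs.exists_embedding (N := N) h1 (by simpa [hV] using h2)
  obtain ⟨s1, s2, s3⟩ := hs.labeling_spec f hf
  refine ⟨_, s1, s2, ?_, s3⟩
  rintro ⟨a, ⟨φ⟩⟩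
  have hadj : ∀ {i j}, (cycleGraph (2 * n + 1)).Adj i j →
      substitution (fun _ _ : Bool => 0) 1 c (f (φ i)) (f (φ j)) = a := by
    intro i j hij
    obtain ⟨H, h⟩ := (TopEdgeLabeling.labelGraph_adj _ _).1 (φ.toHom.map_adj hij)
    exact congrArg Fin.val h
  by_cases ha : a.val = 0
  · -- the outer color class is bipartite
    have hcol : (cycleGraph (2 * n + 1)).Colorable 2 := by
      have C : (cycleGraph (2 * n + 1)).Coloring Bool :=
        Coloring.mk (fun i => (f (φ i)).1) fun {i j} hij e => by
          have := hadj hij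
          simp only [substitution, e, if_true] at this
          omega
      simpa using C.colorable
    have h3 := chromaticNumber_cycleGraph_of_odd (2 * n + 1) (by omega) ⟨n, rfl⟩
    have h4 := hcol.chromaticNumber_le
    rw [h3] at h4
    exact absurd h4 (by decide)
  · -- the other color classes do not leave a copy of the inner coloring
    have hside : ∀ i j, (f (φ i)).1 = (f (φ j)).1 := by
      intro i j
      obtain ⟨p⟩ := cycleGraph_preconnected (n := 2 * n + 1) i j
      induction p with
      | nil => rfl
      | cons h _ ih =>
        refine Eq.trans ?_ ih
        by_contra hne
        have := hadj h
        simp only [substitution, hne, if_false] at this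
        exact ha this.symm
    have := Fintype.card_le_of_injective (fun i => (f (φ i)).2) fun i j hij =>
      φ.injective (f.injective (Prod.ext (hside i j) hij))
    simp [hV] at this
    omega

theorem two_mul_add_one_le_five_pow (m : ℕ) : 2 * m + 1 ≤ 5 ^ m := by
  induction m with
  | zero => rfl
  | succ m ih => rw [pow_succ]; omega

theorem mixedSet_nonempty {k N : ℕ} (hk : 1 ≤ k) (h : MixedColorable k N) :
    (mixedSet k).Nonempty := by
  classical
  -- The search starts at `N` because colorability is not monotone: very small orders cannot show
  -- all colors.
  let P := fun i => ¬ MixedColorable k (N + i)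
  have hP : ∃ i, P i := ⟨maxOrder k + 1, fun h => by have := h.le_maxOrder hk; omega⟩
  have h0 : Nat.find hP ≠ 0 := fun e => (e ▸ Nat.find_spec hP : P 0) h
  refine ⟨N + Nat.find hP, by omega, Nat.find_spec hP, ?_⟩
  have := not_not.1 (Nat.find_min hP (Nat.sub_one_lt h0))
  rwa [← Nat.add_sub_assoc (by omega)] at this

theorem five_pow_lt_of_real {m n : ℕ} (h : ((5 : ℝ) ^ m - 1) / 2 < n) : 5 ^ m < 2 * n + 1 := by
  have : (5 : ℝ) ^ m < 2 * n + 1 := by linarith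
  exact_mod_cast this

theorem mixedPatternSet_eq {W : Type} {H : SimpleGraph W} {k : ℕ}
    (h : ∀ N, MixedColorable k N → MixedPatternColorable H k N) :
    mixedPatternSet H k = mixedSet k := by
  have : ∀ N, MixedPatternColorable H k N ↔ MixedColorable k N :=
    fun N => ⟨fun hN => hN.mixedColorable, h N⟩
  simp only [mixedPatternSet, mixedSet, this]

end MixedRamsey

/-- The exponents `(k - 1) / 2` and `k / 2` are divisions of natural numbers, exact under the
respective parity hypothesis. Nonemptiness says that both Ramsey numbers really exist. -/
theorem mainTheorem8 (k n : ℕ) (hk : 2 ≤ k) (hn : 1 ≤ n) :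
    (Odd k → ((5 : ℝ) ^ ((k - 1) / 2) - 1) / 2 < (n : ℝ) →
      (MixedRamsey.mixedSet k).Nonempty ∧
      (MixedRamsey.mixedPatternSet (SimpleGraph.cycleGraph (2 * n + 1)) k).Nonempty ∧
      MixedRamsey.M k (SimpleGraph.cycleGraph (2 * n + 1)) = MixedRamsey.R k) ∧
    (Even k → ((5 : ℝ) ^ (k / 2) - 1) / 2 < (n : ℝ) →
      (MixedRamsey.mixedSet k).Nonempty ∧
      (MixedRamsey.mixedPatternSet (SimpleGraph.cycleGraph (2 * n + 1)) k).Nonempty ∧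
      MixedRamsey.M k (SimpleGraph.cycleGraph (2 * n + 1)) = MixedRamsey.R k) := by
  open MixedRamsey in
  refine ⟨?_, ?_⟩
  · rintro ⟨m, rfl⟩ h
    rw [show (2 * m + 1 - 1) / 2 = m by omega] at h
    have hm := five_pow_lt_of_real h
    have h5 := two_mul_add_one_le_five_pow m
    have hne := mixedSet_nonempty (by omega)
      (mixedPatternColorable_of_le (N := 2 * 5 ^ m) hn hm (by omega) le_rfl).mixedColorable
    have heq : mixedPatternSet (SimpleGraph.cycleGraph (2 * n + 1)) (2 * m + 1) =
        mixedSet (2 * m + 1) := mixedPatternSet_eq fun N hN => by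
      -- Below `2n + 1` the given coloring is kept; from there on it is replaced. Then `N > 5 ^ m ≥
      -- 2m + 1` leaves room for a star with all colors.
      rcases lt_or_ge N (2 * n + 1) with hlt | hge
      · exact mixedPatternColorable_cycleGraph_of_lt hlt hN
      · exact mixedPatternColorable_of_le hn hm (by omega)
          (maxOrder_two_mul_add_one m ▸ hN.le_maxOrder (by omega))
    exact ⟨hne, heq ▸ hne, by rw [M, R, heq]⟩
  · rintro hk2 h
    obtain ⟨m, rfl⟩ := hk2.two_dvd
    rw [show 2 * m / 2 = m by omega] at h
    have hm := five_pow_lt_of_real h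
    have hne := mixedSet_nonempty (by omega)
      (mixedColorable_of_le (two_mul_add_one_le_five_pow m) le_rfl)
    have heq : mixedPatternSet (SimpleGraph.cycleGraph (2 * n + 1)) (2 * m) =
        mixedSet (2 * m) := mixedPatternSet_eq fun N hN =>
      mixedPatternColorable_cycleGraph_of_lt
        ((maxOrder_two_mul m ▸ hN.le_maxOrder (by omega)).trans_lt hm) hN
    exact ⟨hne, heq ▸ hne, by rw [M, R, heq]⟩
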